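/- Notation. Let $r\ge 1$, $n\ge 1$, $\underline t=(t_1,\dots,t_r)$, $\underline X=(X_1,\dots,X_r)$, let $\preceq$ be the product order on $\mathbb N^r$, let $\mathbb C\{\cdot\}$ denote rings of convergent power series, and let $\mathrm{supp}(q)$ be the set of exponents occurring in $q$ with non-zero coefficient. A *quasi-ordinary parameterization* is a tuple $H=(t_1^n,\dots,t_r^n,S(\underline t))$ with $S\in\mathbb C\{\underline t\}$ such that $f(t_1^n,\dots,t_r^n,S)=0$ for an irreducible Weierstrass polynomial $f\in\mathbb C\{\underline X\}[X_{r+1}]$ whose discriminant is a monomial times a unit (for instance $n=\deg f$). Its *characteristic exponents* $\lambda_1\prec\dots\prec\lambda_g$ are the distinct exponents $\mu\in\mathbb N^r$ for which two roots $S',S''\in\mathbb C\{\underline t\}$ of $f(t_1^n,\dots,t_r^n,Y)$ satisfy $S'-S''=\underline t^{\mu}\cdot$unit; we assume $g\ge 1$ and write $\lambda_k=(\lambda_{k1},\dots,\lambda_{kr})$. The parameterization is *normalized* if $S=u\,\underline t^{\lambda_1}$ with $u(\underline 0)=1$; $(\lambda_{1i},\dots,\lambda_{gi})\ge_{lex}(\lambda_{1j},\dots,\lambda_{gj})$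 for $i<j$; and $\lambda_{11}>n$ if $\lambda_1=(\lambda_{11},0,\dots,0)$. A series $q\ne0$ has *dominant exponent* $v$ if its Newton polyhedron, the convex hull of $\mathrm{supp}(q)+\mathbb R^r_{\ge0}$, has $v$ as its only vertex. Let $\Gamma_H\subset\mathbb N^r$ be the set of dominant exponents of those series $h(t_1^n,\dots,t_r^n,S)$, $h\in\mathbb C\{\underline X,X_{r+1}\}$, that have one. Let $\nu_i=n\theta_i$, where $\theta_i$ is the $i$-th canonical basis vector. A normalized $H$ is *quasi-short* if no element of $\mathrm{supp}(S-\underline t^{\lambda_1})$ lies in $\Gamma_H\cup\bigcup_{i:\,\lambda_{1i}\ge n}(\Gamma_H+2\lambda_1-\nu_i)$. The set $E_{\mathcal Z}(H)$ of *generalized Zariski exponents* of a quasi-short $H$ is the set of $\preceq$-minimal elements of $\mathrm{supp}(S-\underline t^{\lambda_1})$, and $E_{\mathcal Z}(H)=\{\underline\infty\}$ if $S=\underline t^{\lambda_1}$. Let $\widetilde{\mathcal A}$ be the set of pairs $(\sigma,\rho)$ of germs of analytic isomorphisms of $(\mathbb C^{r+1},0)$ and $(\mathbb C^r,0)$ of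 the form $$\rho_i=t_i(c_i+\zeta_i),\qquad \sigma_i=a_iX_i+X_i\epsilon_i+X_{r+1}\eta_i\quad(1\le i\le r),\qquad \sigma_{r+1}=a_{r+1}X_{r+1}+X_{r+1}\epsilon_{r+1}+\underline X^{\alpha}\eta_{r+1},$$ where $\alpha=(\lceil\lambda_{11}/n\rceil,\dots,\lceil\lambda_{1r}/n\rceil)$, all $c_i,a_i,a_{r+1}\in\mathbb C\setminus\{0\}$, the $\zeta_i\in\mathbb C\{\underline t\}$ and $\epsilon_i,\epsilon_{r+1}\in\mathbb C\{\underline X,X_{r+1}\}$ vanish at the origin, $\eta_i,\eta_{r+1}\in\mathbb C\{\underline X,X_{r+1}\}$, and $\eta_i=0$ whenever $\lambda_{1i}<n$ $(1\le i\le r)$. Let $\widetilde{\mathcal A}_1\subset\widetilde{\mathcal A}$ consist of the pairs with 1-jets $j^1\sigma=(X_1+d_1X_{r+1},\dots,X_r+d_rX_{r+1},X_{r+1})$ (with $d_i\in\mathbb C$, $d_i=0$ if $\lambda_{1i}<n$) and $j^1\rho=\underline t$. **Theorem.** Let $H_1=(t_1^n,\dots,t_r^n,S_1)$ and $H_2=(t_1^n,\dots,t_r^n,S_2)$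 be quasi-short parameterizations with the same $n$ and the same characteristic exponents $\lambda_1,\dots,\lambda_g$. 1. If $H_1$ and $H_2$ are $\widetilde{\mathcal A}$-equivalent, i.e. $H_2=\sigma\circ H_1\circ\rho^{-1}$ for some $(\sigma,\rho)\in\widetilde{\mathcal A}$, then $E_{\mathcal Z}(H_1)=E_{\mathcal Z}(H_2)$. 2. If $H_2=\sigma\circ H_1\circ\rho^{-1}$ for some $(\sigma,\rho)\in\widetilde{\mathcal A}_1$, then for every (finite) $\delta\in E_{\mathcal Z}(H_1)$ the coefficients of $\underline t^{\delta}$ in $S_1$ and in $S_2$ are equal. -/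

import Mathlib

open MvPowerSeries

/-! ### Convergent power series -/

/-- Absolute convergence at some point `(R, …, R)` with `R > 0`. -/
def IsConvergent {k : ℕ} (f : MvPowerSeries (Fin k) ℂ) : Prop :=
  ∃ R : ℝ, 0 < R ∧ Summable fun m : Fin k →₀ ℕ => ‖coeff m f‖ * R ^ m.degree

theorem IsConvergent.common_radius {k : ℕ} {f h : MvPowerSeries (Fin k) ℂ}
    (hf : IsConvergent f) (hh : IsConvergent h) :
    ∃ R : ℝ, 0 < R ∧ (Summable fun m : Fin k →₀ ℕ => ‖coeff m f‖ * R ^ m.degree) ∧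
      Summable fun m : Fin k →₀ ℕ => ‖coeff m h‖ * R ^ m.degree := by
  obtain ⟨R, hR, hf⟩ := hf
  obtain ⟨R', hR', hh⟩ := hh
  have hm : 0 < min R R' := lt_min hR hR'
  refine ⟨min R R', hm, ?_, ?_⟩
  · refine hf.of_nonneg_of_le (fun m => by positivity) (fun m => ?_)
    exact mul_le_mul_of_nonneg_left (pow_le_pow_left₀ hm.le (min_le_left _ _) _) (norm_nonneg _)
  · refine hh.of_nonneg_of_le (fun m => by positivity) (fun m => ?_)
    exact mul_le_mul_of_nonneg_left (pow_le_pow_left₀ hm.le (min_le_right _ _) _) (norm_nonneg _)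

theorem IsConvergent.add {k : ℕ} {f h : MvPowerSeries (Fin k) ℂ}
    (hf : IsConvergent f) (hh : IsConvergent h) : IsConvergent (f + h) := by
  obtain ⟨R, hR, h1, h2⟩ := hf.common_radius hh
  refine ⟨R, hR, (h1.add h2).of_nonneg_of_le (fun m => by positivity) (fun m => ?_)⟩
  rw [map_add, ← add_mul]
  exact mul_le_mul_of_nonneg_right (norm_add_le _ _) (by positivity)

theorem coeff_mul_norm_le {k : ℕ} (f h : MvPowerSeries (Fin k) ℂ) {R : ℝ} (hR : 0 < R)
    (m : Fin k →₀ ℕ) :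
    ‖coeff m (f * h)‖ * R ^ m.degree ≤ ∑ p ∈ Finset.HasAntidiagonal.antidiagonal m,
      (‖coeff p.1 f‖ * R ^ p.1.degree) * (‖coeff p.2 h‖ * R ^ p.2.degree) := by
  have key : ∀ p ∈ Finset.HasAntidiagonal.antidiagonal m, ‖coeff p.1 f * coeff p.2 h‖ * R ^ m.degree =
      (‖coeff p.1 f‖ * R ^ p.1.degree) * (‖coeff p.2 h‖ * R ^ p.2.degree) := by
    intro p hp
    have hd : m.degree = p.1.degree + p.2.degree := by
      rw [← Finset.HasAntidiagonal.mem_antidiagonal.mp hp, map_add]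
    rw [norm_mul, hd, pow_add]
    ring
  rw [← Finset.sum_congr rfl key, ← Finset.sum_mul, coeff_mul]
  exact mul_le_mul_of_nonneg_right (norm_sum_le _ _) (pow_pos hR _).le

theorem IsConvergent.mul {k : ℕ} {f h : MvPowerSeries (Fin k) ℂ}
    (hf : IsConvergent f) (hh : IsConvergent h) : IsConvergent (f * h) := by
  obtain ⟨R, hR, h1, h2⟩ := hf.common_radius hh
  have n1 : ∀ m : Fin k →₀ ℕ, 0 ≤ ‖coeff m f‖ * R ^ m.degree := fun m =>
    mul_nonneg (norm_nonneg _) (pow_pos hR _).le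
  have n2 : ∀ m : Fin k →₀ ℕ, 0 ≤ ‖coeff m h‖ * R ^ m.degree := fun m =>
    mul_nonneg (norm_nonneg _) (pow_pos hR _).le
  have hprod := summable_sum_mul_antidiagonal_of_summable_mul (A := Fin k →₀ ℕ)
    (f := fun m => ‖coeff m f‖ * R ^ m.degree) (g := fun m => ‖coeff m h‖ * R ^ m.degree)
    (h1.mul_of_nonneg h2 n1 n2)
  exact ⟨R, hR, Summable.of_nonneg_of_le
    (fun m => mul_nonneg (norm_nonneg _) (pow_pos hR _).le)
    (fun m => coeff_mul_norm_le f h hR m) hprod⟩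

theorem isConvergent_algebraMap {k : ℕ} (c : ℂ) :
    IsConvergent (algebraMap ℂ (MvPowerSeries (Fin k) ℂ) c) := by
  classical
  refine ⟨1, one_pos, summable_of_ne_finset_zero (s := {0}) fun m hm => ?_⟩
  rw [Finset.mem_singleton] at hm
  simp [MvPowerSeries.algebraMap_apply, coeff_C, hm]

/-- The ring `ℂ{x₁, …, x_k}` of convergent power series. -/
def convergent (k : ℕ) : Subalgebra ℂ (MvPowerSeries (Fin k) ℂ) where
  carrier := {f | IsConvergent f}
  mul_mem' hf hh := IsConvergent.mul hf hh
  add_mem' hf hh := IsConvergent.add hf hh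
  algebraMap_mem' c := isConvergent_algebraMap c

/-- The support of a power series. -/
def supp {k : ℕ} (q : MvPowerSeries (Fin k) ℂ) : Set (Fin k →₀ ℕ) := {m | coeff m q ≠ 0}

/-! ### Quasi-ordinary branches and their parameterizations -/

/-- `f ∈ ℂ{X₁, …, X_r}[X_{r+1}]` is an irreducible Weierstrass polynomial whose discriminant is
a monomial times a unit. -/
structure IsQuasiOrdinary {r : ℕ} (f : Polynomial (convergent r)) : Prop where
  monic : f.Monic
  weierstrass : ∀ i < f.natDegree, constantCoeff (f.coeff i : MvPowerSeries (Fin r) ℂ) = 0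
  irreducible : Irreducible f
  discr : ∃ (δ : Fin r →₀ ℕ) (u : MvPowerSeries (Fin r) ℂ), u ∈ convergent r ∧
    constantCoeff u ≠ 0 ∧ (f.discr : MvPowerSeries (Fin r) ℂ) = monomial δ 1 * u

/-- `S ∈ ℂ{t₁, …, t_r}` with `f(t₁ⁿ, …, t_rⁿ, S(t)) = 0`, i.e. `S(X₁^{1/n}, …, X_r^{1/n})` is a
root of `f` in `ℂ{X₁^{1/n}, …, X_r^{1/n}}`. -/
def IsBranch {r : ℕ} (n : ℕ) [NeZero n] (f : Polynomial (convergent r))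
    (S : MvPowerSeries (Fin r) ℂ) : Prop :=
  S ∈ convergent r ∧
    f.eval₂ (((expand n (NeZero.ne n)).comp (convergent r).val :
      convergent r →ₐ[ℂ] MvPowerSeries (Fin r) ℂ) : convergent r →+* MvPowerSeries (Fin r) ℂ) S = 0

/-- The exponents `λ(i, j)`, multiplied by `n`, of the differences
`ξ_i - ξ_j = X^{λ(i, j) / n} · unit` of the roots of `f`; in the variables `t_i = X_i^{1/n}`. -/
def charExponents {r : ℕ} (n : ℕ) [NeZero n] (f : Polynomial (convergent r)) :
    Set (Fin r →₀ ℕ) :=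
  {μ | ∃ S S' u : MvPowerSeries (Fin r) ℂ, IsBranch n f S ∧ IsBranch n f S' ∧
    u ∈ convergent r ∧ constantCoeff u ≠ 0 ∧ S - S' = monomial μ 1 * u}

/-- `(t₁ⁿ, …, t_rⁿ, S(t))` is a quasi-ordinary parameterization with generalized characteristic
exponents `lam 0 ≺ lam 1 ≺ ⋯ ≺ lam g` (so `lam 0` is the first one, written `λ₁` on paper). -/
def IsQuasiOrdinaryParam {r g : ℕ} (n : ℕ) [NeZero n] (lam : Fin (g + 1) → (Fin r →₀ ℕ))
    (S : MvPowerSeries (Fin r) ℂ) : Prop :=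
  ∃ f : Polynomial (convergent r), IsQuasiOrdinary f ∧ IsBranch n f S ∧
    StrictMono lam ∧ Set.range lam = charExponents n f

/-- Normalized quasi-ordinary parameterizations. -/
structure IsNormalizedParam {r g : ℕ} (n : ℕ) [NeZero n] (lam : Fin (g + 1) → (Fin r →₀ ℕ))
    (S : MvPowerSeries (Fin r) ℂ) : Prop where
  param : IsQuasiOrdinaryParam n lam S
  leading : ∃ u : MvPowerSeries (Fin r) ℂ, u ∈ convergent r ∧ constantCoeff u = 1 ∧
    S = u * monomial (lam 0) 1
  lex : ∀ i j : Fin r, i < j → toLex (fun k => lam k j) ≤ toLex (fun k => lam k i)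
  first : ∀ i : Fin r, (i : ℕ) = 0 → (∀ j, j ≠ i → lam 0 j = 0) → n < lam 0 i

/-- The tuple `H = (t₁ⁿ, …, t_rⁿ, S(t))`. -/
noncomputable def paramTuple {r : ℕ} (n : ℕ) (S : MvPowerSeries (Fin r) ℂ) :
    Fin (r + 1) → MvPowerSeries (Fin r) ℂ :=
  Fin.snoc (fun i : Fin r => (X i : MvPowerSeries (Fin r) ℂ) ^ n) S

/-! ### The associated semigroup -/

/-- The Newton polyhedron: the convex hull of `supp q + ℝ^k_{≥ 0}`. -/
def newtonPolyhedron {k : ℕ} (q : MvPowerSeries (Fin k) ℂ) : Set (Fin k → ℝ) :=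
  convexHull ℝ {x | ∃ m ∈ supp q, ∀ i, (m i : ℝ) ≤ x i}

/-- `q` has dominant exponent `v`: its Newton polyhedron has `v` as its only vertex. -/
def HasDominantExponent {k : ℕ} (q : MvPowerSeries (Fin k) ℂ) (v : Fin k →₀ ℕ) : Prop :=
  q ≠ 0 ∧ (newtonPolyhedron q).extremePoints ℝ = {fun i => (v i : ℝ)}

/-- The semigroup `Γ_H` of the dominant exponents of the elements `h(t₁ⁿ, …, t_rⁿ, S(t))`,
`h ∈ ℂ{X₁, …, X_{r+1}}`. -/
def valueSemigroup {r : ℕ} (n : ℕ) (S : MvPowerSeries (Fin r) ℂ) : Set (Fin r →₀ ℕ) :=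
  {v | ∃ h ∈ convergent (r + 1), HasDominantExponent (subst (paramTuple n S) h) v}

/-- `Γ ∪ ⋃_{i : λ₁ᵢ ≥ n} (Γ + 2 λ₁ - ν_i)` with `ν_i = n θ_i`. -/
def eliminableExponents {r : ℕ} (n : ℕ) (lam₁ : Fin r →₀ ℕ) (S : MvPowerSeries (Fin r) ℂ) :
    Set (Fin r →₀ ℕ) :=
  valueSemigroup n S ∪
    {δ | ∃ i : Fin r, n ≤ lam₁ i ∧ ∃ γ ∈ valueSemigroup n S,
      δ + Finsupp.single i n = γ + 2 • lam₁}

/-! ### Quasi-short parameterizations and generalized Zariski exponents -/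

/-- The non-leading part `S(t) - t^{λ₁}`. -/
noncomputable def nonleading {r : ℕ} (lam₁ : Fin r →₀ ℕ) (S : MvPowerSeries (Fin r) ℂ) :
    MvPowerSeries (Fin r) ℂ :=
  S - monomial lam₁ 1

/-- Quasi-short parameterizations. -/
structure IsQuasiShort {r g : ℕ} (n : ℕ) [NeZero n] (lam : Fin (g + 1) → (Fin r →₀ ℕ))
    (S : MvPowerSeries (Fin r) ℂ) : Prop where
  normalized : IsNormalizedParam n lam S
  short : ∀ δ ∈ supp (nonleading (lam 0) S), δ ∉ eliminableExponents n (lam 0) S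

open Classical in
/-- The generalized Zariski exponents: the minimal elements, for the product order, of the support
of the non-leading part, and `{∞}` if the non-leading part is zero. -/
noncomputable def zariskiExponents {r : ℕ} (lam₁ : Fin r →₀ ℕ) (S : MvPowerSeries (Fin r) ℂ) :
    Set (WithTop (Fin r →₀ ℕ)) :=
  if nonleading lam₁ S = 0 then {⊤}
  else (fun δ : Fin r →₀ ℕ => (δ : WithTop (Fin r →₀ ℕ))) ''
    {δ | Minimal (fun m => m ∈ supp (nonleading lam₁ S)) δ}

/-! ### The groups of coordinate changes -/

/-- Germs of analytic isomorphisms of `(ℂ^k, 0)`. -/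
structure GermIso (k : ℕ) where
  toFun : Fin k → MvPowerSeries (Fin k) ℂ
  invFun : Fin k → MvPowerSeries (Fin k) ℂ
  toFun_mem : ∀ i, toFun i ∈ convergent k
  invFun_mem : ∀ i, invFun i ∈ convergent k
  toFun_zero : ∀ i, constantCoeff (toFun i) = 0
  invFun_zero : ∀ i, constantCoeff (invFun i) = 0
  left_inv : ∀ i, subst toFun (invFun i) = X i
  right_inv : ∀ i, subst invFun (toFun i) = X i

/-- `H₂ = σ ∘ H₁ ∘ ρ⁻¹`, where `H_i = (t₁ⁿ, …, t_rⁿ, S_i(t))`. -/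
def Carries {r : ℕ} (n : ℕ) (σ : GermIso (r + 1)) (ρ : GermIso r)
    (S₁ S₂ : MvPowerSeries (Fin r) ℂ) : Prop :=
  ∀ j, paramTuple n S₂ j = subst ρ.invFun (subst (paramTuple n S₁) (σ.toFun j))

/-- The monomial `X₁^{⌈λ₁₁ / n⌉} ⋯ X_r^{⌈λ₁ᵣ / n⌉}` in `ℂ{X₁, …, X_{r+1}}`. -/
noncomputable def ceilMonomial {r : ℕ} (n : ℕ) (lam₁ : Fin r →₀ ℕ) :
    MvPowerSeries (Fin (r + 1)) ℂ :=
  ∏ i : Fin r, X i.castSucc ^ ⌈(lam₁ i : ℚ) / n⌉₊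

/-- The group `Ã`. -/
def Atilde {r : ℕ} (n : ℕ) (lam₁ : Fin r →₀ ℕ) : Set (GermIso (r + 1) × GermIso r) :=
  {p | ∃ (c : Fin r → ℂ) (ζ : Fin r → MvPowerSeries (Fin r) ℂ) (a : Fin (r + 1) → ℂ)
      (ε η : Fin (r + 1) → MvPowerSeries (Fin (r + 1)) ℂ),
    (∀ i, c i ≠ 0) ∧ (∀ j, a j ≠ 0) ∧
    (∀ i, ζ i ∈ convergent r ∧ constantCoeff (ζ i) = 0) ∧
    (∀ j, ε j ∈ convergent (r + 1) ∧ constantCoeff (ε j) = 0) ∧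
    (∀ j, η j ∈ convergent (r + 1)) ∧
    (∀ i : Fin r, lam₁ i < n → η i.castSucc = 0) ∧
    (∀ i : Fin r, p.2.toFun i = X i * (C (c i) + ζ i)) ∧
    (∀ i : Fin r, p.1.toFun i.castSucc = C (a i.castSucc) * X i.castSucc +
      (X i.castSucc * ε i.castSucc + X (Fin.last r) * η i.castSucc)) ∧
    p.1.toFun (Fin.last r) = C (a (Fin.last r)) * X (Fin.last r) +
      (X (Fin.last r) * ε (Fin.last r) + ceilMonomial n lam₁ * η (Fin.last r))}

/-- Equality of 1-jets: the same coefficients in total degree at most `1`. -/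
def SameOneJet {k : ℕ} (f h : MvPowerSeries (Fin k) ℂ) : Prop :=
  ∀ m : Fin k →₀ ℕ, m.degree ≤ 1 → coeff m f = coeff m h

/-- The subset `Ã₁` of `Ã`. -/
def AtildeOne {r : ℕ} (n : ℕ) (lam₁ : Fin r →₀ ℕ) : Set (GermIso (r + 1) × GermIso r) :=
  {p | p ∈ Atilde n lam₁ ∧
    (∃ d : Fin r → ℂ, (∀ i, lam₁ i < n → d i = 0) ∧
      ∀ i : Fin r, SameOneJet (p.1.toFun i.castSucc) (X i.castSucc + C (d i) * X (Fin.last r))) ∧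
    SameOneJet (p.1.toFun (Fin.last r)) (X (Fin.last r)) ∧
    ∀ i : Fin r, SameOneJet (p.2.toFun i) (X i)}

/-! Write `λ = lam 0`, `ρ_i = t_i v_i`, and let `Γ` be the semigroup generated by `n ℕ^r` and `λ`.
Let `δ` be minimal in the union of the supports of the two non-leading parts `N₁`, `N₂`. Everything
reduces to `(∏ v_i(0)^{δ_i}) · [t^δ] N₂ = a_{r+1} · [t^δ] N₁` (`coeff_nonleading_of_minimal`): the
multipliers are non-zero, so the two supports have the same minimal elements, and for 1-jets as in
`AtildeOne` the multipliers are 1.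

To get this relation, compare coefficients in `H₂ ∘ ρ = σ ∘ H₁`. Strictly below `δ`, every series in
the components of `H₁` has exponents in `Γ`, while `δ ∉ Γ`. Hence the last component gives the
relation up to one extra term, the coefficient of `t^δ` in `t^λ ∏ v_i^{λ_i}`. The other components
show that an exponent `e` of `v_i^n` with `e + λ ≤ δ` lies in `Γ` or, when `λ_i ≥ n`, in `Γ + λ -
nθ_i`.

These sets do not form a semigroup, so the information does not pass directly from `v_i^n` to `v_i`.
The last component, read strictly below `δ`, supplies the missing constraint: `∏ v_i^{λ_i}` has no
coefficient at `e` if `e + λ < δ` and `e + λ ∉ Γ`. This confines the `v_i` to `extendedSemigroup`,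
which is closed under addition. At an exponent outside a semigroup containing all smaller exponents,
the normalized coefficient `logCoeff` is additive on products (`logCoeff_mul`), so powers and
products become linear. At `e = δ - λ`, an exponent of `v_i` would make `δ` eliminable, so the extra
term vanishes (`coeff_prod_pow_eq_zero`). -/

/-! ### Power series with restricted support -/

/-- The power series whose support lies in `T`, a multiplicative submonoid. -/
def supportedIn {k : ℕ} (T : AddSubmonoid (Fin k →₀ ℕ)) :
    Submonoid (MvPowerSeries (Fin k) ℂ) where
  carrier := {f | ∀ m, coeff m f ≠ 0 → m ∈ T}
  one_mem' m hm := by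
    classical
    rw [coeff_one] at hm
    rw [show m = 0 by by_contra h; simp [h] at hm]
    exact T.zero_mem
  mul_mem' {f h} hf hh m hm := by
    classical
    rw [coeff_mul] at hm
    obtain ⟨p, hp, hne⟩ := Finset.exists_ne_zero_of_sum_ne_zero hm
    rw [← Finset.HasAntidiagonal.mem_antidiagonal.mp hp]
    exact T.add_mem (hf _ (left_ne_zero_of_mul hne)) (hh _ (right_ne_zero_of_mul hne))

theorem exists_coeff_ne_zero_of_coeff_subst_ne_zero {k l : ℕ} {a : Fin k → MvPowerSeries (Fin l) ℂ}
    (ha : HasSubst a) {f : MvPowerSeries (Fin k) ℂ} {m : Fin l →₀ ℕ}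
    (hm : coeff m (subst a f) ≠ 0) :
    ∃ d, coeff d f ≠ 0 ∧ coeff m (d.prod fun s e => a s ^ e) ≠ 0 := by
  rw [coeff_subst ha] at hm
  by_contra! hc
  refine hm (finsum_eq_zero_of_forall_eq_zero fun d => ?_)
  by_cases h : coeff d f = 0
  · simp [h]
  · rw [hc d h, smul_zero]

theorem subst_mem_supportedIn {k l : ℕ} {T : AddSubmonoid (Fin l →₀ ℕ)}
    {a : Fin k → MvPowerSeries (Fin l) ℂ} (ha : HasSubst a) (haT : ∀ s, a s ∈ supportedIn T)
    (f : MvPowerSeries (Fin k) ℂ) : subst a f ∈ supportedIn T := fun m hm => by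
  obtain ⟨d, -, hd⟩ := exists_coeff_ne_zero_of_coeff_subst_ne_zero ha hm
  exact Submonoid.prod_mem (supportedIn T) (fun s _ => pow_mem (haT s) _) m hd

/-- The union of an additive submonoid of `ℕ^k` and an upper set. -/
def AddSubmonoid.unionUpper {k : ℕ} (T : AddSubmonoid (Fin k →₀ ℕ)) (P : UpperSet (Fin k →₀ ℕ)) :
    AddSubmonoid (Fin k →₀ ℕ) where
  carrier := (T : Set (Fin k →₀ ℕ)) ∪ P
  zero_mem' := Or.inl T.zero_mem
  add_mem' {a b} ha hb := by
    rcases ha with ha | ha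
    · rcases hb with hb | hb
      · exact Or.inl (T.add_mem ha hb)
      · exact Or.inr (P.upper le_add_self hb)
    · exact Or.inr (P.upper le_self_add ha)

/-! ### Coefficients of products at an exponent outside a semigroup -/

/-- The coefficient of `t^e`, divided by the constant coefficient. -/
noncomputable def logCoeff {k : ℕ} (e : Fin k →₀ ℕ) (f : MvPowerSeries (Fin k) ℂ) : ℂ :=
  coeff e f / constantCoeff f

/-- The unit power series whose exponents strictly below `e` all lie in `T`. -/
def unitsSupportedBelow {k : ℕ} (T : AddSubmonoid (Fin k →₀ ℕ)) (e : Fin k →₀ ℕ) :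
    Submonoid (MvPowerSeries (Fin k) ℂ) where
  carrier := {f | constantCoeff f ≠ 0 ∧ ∀ m < e, coeff m f ≠ 0 → m ∈ T}
  one_mem' := ⟨by simp, fun m _ hm => (supportedIn T).one_mem m hm⟩
  mul_mem' {f h} hf hh := by
    classical
    refine ⟨by simpa using ⟨hf.1, hh.1⟩, fun m hme hm => ?_⟩
    rw [coeff_mul] at hm
    obtain ⟨p, hp, hne⟩ := Finset.exists_ne_zero_of_sum_ne_zero hm
    rw [← Finset.HasAntidiagonal.mem_antidiagonal.mp hp] at hme ⊢
    exact T.add_mem (hf.2 _ (le_self_add.trans_lt hme) (left_ne_zero_of_mul hne))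
      (hh.2 _ (le_add_self.trans_lt hme) (right_ne_zero_of_mul hne))

section logCoeff

variable {k : ℕ} {T : AddSubmonoid (Fin k →₀ ℕ)} {e : Fin k →₀ ℕ}

/-- In any splitting `e = a + b` with both parts non-zero, `a` and `b` are strictly below `e`. If
both occurred they would lie in `T`, and so would `e`. Only the two trivial splittings contribute: a
Leibniz rule, which division by the constant terms makes additive. -/
theorem logCoeff_mul (he : e ∉ T) {f h : MvPowerSeries (Fin k) ℂ}
    (hf : f ∈ unitsSupportedBelow T e) (hh : h ∈ unitsSupportedBelow T e) :
    logCoeff e (f * h) = logCoeff e f + logCoeff e h := by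
  classical
  have h0 : e ≠ 0 := fun h => he (h ▸ T.zero_mem)
  have key : coeff e (f * h) = coeff 0 f * coeff e h + coeff e f * coeff 0 h := by
    rw [coeff_mul, Finset.sum_eq_add (0, e) (e, 0)]
    · simp [h0]
    · rintro ⟨a, b⟩ hab ⟨hn1, hn2⟩
      rw [Finset.HasAntidiagonal.mem_antidiagonal] at hab
      dsimp only at hab ⊢
      by_contra hne
      have ha : a ≠ 0 := by rintro rfl; exact hn1 (by simpa using hab)
      have hb : b ≠ 0 := by rintro rfl; exact hn2 (by simpa using hab)
      subst hab
      exact he (T.add_mem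
        (hf.2 _ (lt_add_of_pos_right _ (pos_iff_ne_zero.2 hb)) (left_ne_zero_of_mul hne))
        (hh.2 _ (lt_add_of_pos_left _ (pos_iff_ne_zero.2 ha)) (right_ne_zero_of_mul hne)))
    · simp
    · simp
  have hf0 := hf.1
  have hh0 := hh.1
  rw [logCoeff, logCoeff, logCoeff, key, map_mul, coeff_zero_eq_constantCoeff_apply,
    coeff_zero_eq_constantCoeff_apply]
  field_simp
  ring

theorem logCoeff_one (he : e ∉ T) : logCoeff e (1 : MvPowerSeries (Fin k) ℂ) = 0 := by
  classical
  have h0 : e ≠ 0 := fun h => he (h ▸ T.zero_mem)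
  simp [logCoeff, coeff_one, h0]

theorem logCoeff_pow (he : e ∉ T) {f : MvPowerSeries (Fin k) ℂ}
    (hf : f ∈ unitsSupportedBelow T e) (q : ℕ) : logCoeff e (f ^ q) = q * logCoeff e f := by
  induction q with
  | zero => simp [logCoeff_one he]
  | succ q ih =>
    rw [pow_succ, logCoeff_mul he (pow_mem hf q) hf, ih]
    push_cast
    ring

theorem logCoeff_prod_pow (he : e ∉ T) {ι : Type*} (s : Finset ι)
    {f : ι → MvPowerSeries (Fin k) ℂ} (hf : ∀ i, f i ∈ unitsSupportedBelow T e) (q : ι → ℕ) :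
    logCoeff e (∏ i ∈ s, f i ^ q i) = ∑ i ∈ s, q i * logCoeff e (f i) := by
  classical
  induction s using Finset.induction_on with
  | empty => simp [logCoeff_one he]
  | insert i s hi ih =>
    rw [Finset.prod_insert hi, Finset.sum_insert hi,
      logCoeff_mul he (pow_mem (hf i) _) (prod_mem fun j _ => pow_mem (hf j) _), ih,
      logCoeff_pow he (hf i)]

end logCoeff

/-! ### The semigroup generated by `n ℕ^r` and the first characteristic exponent -/

/-- The semigroup generated by `n ℕ^r` and `lam`. -/
def monomialSemigroup {r : ℕ} (n : ℕ) (lam : Fin r →₀ ℕ) : AddSubmonoid (Fin r →₀ ℕ) where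
  carrier := {m | ∃ (a : Fin r →₀ ℕ) (q : ℕ), m = n • a + q • lam}
  zero_mem' := ⟨0, 0, by simp⟩
  add_mem' := by
    rintro _ _ ⟨a, q, rfl⟩ ⟨b, p, rfl⟩
    exact ⟨a + b, q + p, by rw [nsmul_add, add_nsmul]; abel⟩

section Semigroup

variable {r n : ℕ} {lam : Fin r →₀ ℕ}

theorem nsmul_mem_monomialSemigroup (a : Fin r →₀ ℕ) : n • a ∈ monomialSemigroup n lam :=
  ⟨a, 0, by simp⟩

theorem self_mem_monomialSemigroup : lam ∈ monomialSemigroup n lam :=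
  ⟨0, 1, by simp⟩

theorem mem_monomialSemigroup_of_add_single {e a : Fin r →₀ ℕ} {i : Fin r} {q : ℕ}
    (h : e + Finsupp.single i n = n • a + q • lam) (ha : a i ≠ 0) :
    e ∈ monomialSemigroup n lam := by
  refine ⟨a - Finsupp.single i 1, q, ?_⟩
  have hle : Finsupp.single i 1 ≤ a := by
    rw [Finsupp.single_le_iff]; omega
  have hs : n • (a - Finsupp.single i 1) + Finsupp.single i n = n • a := by
    conv_rhs => rw [← tsub_add_cancel_of_le hle]
    rw [nsmul_add]
    simp
  apply add_right_cancel (b := Finsupp.single i n)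
  rw [h, ← hs]
  abel

/-- Ensures that outside `Γ` at most one `v_i` can have a coefficient at a given exponent, so no
cancellation between different indices can occur. -/
theorem mem_monomialSemigroup_of_add_single_eq {e γ γ' : Fin r →₀ ℕ} {i j : Fin r} (hn : n ≠ 0)
    (hij : i ≠ j) (hγ : γ ∈ monomialSemigroup n lam) (hγ' : γ' ∈ monomialSemigroup n lam)
    (hi : e + Finsupp.single i n = γ + lam) (hj : e + Finsupp.single j n = γ' + lam) :
    e ∈ monomialSemigroup n lam := by
  obtain ⟨a, q, rfl⟩ := hγ
  obtain ⟨c, p, rfl⟩ := hγ'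
  wlog hpq : p ≤ q generalizing a c p q i j
  · exact this hij.symm c p hj a q hi (by omega)
  refine mem_monomialSemigroup_of_add_single (i := j) (a := c) (q := p + 1)
    (by rw [hj, add_nsmul]; simp [add_assoc]) fun hc => ?_
  -- With `c j = 0`, the `j`-th coordinates give `e j + n = (p + 1) * lam j ≤ (q + 1) * lam j ≤ e
  -- j`, which is absurd.
  have h1 := DFunLike.congr_fun hi j
  have h2 := DFunLike.congr_fun hj j
  have h3 := Nat.mul_le_mul_right (lam j) hpq
  simp [Finsupp.single_eq_of_ne hij.symm, hc] at h1 h2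
  have : 0 ≤ n * a j := Nat.zero_le _
  omega

/-- The elements of the semigroup `Γ` generated by `n ℕ^r` and `lam`, and those elements of the
translates `Γ + lam - n θ_i` that become multiples of `n` after adding `lam`. -/
def extendedSemigroup {r : ℕ} (n : ℕ) (lam : Fin r →₀ ℕ) : AddSubmonoid (Fin r →₀ ℕ) where
  carrier := {e | e ∈ monomialSemigroup n lam ∨ (∃ c : Fin r →₀ ℕ, e + lam = n • c) ∧
    ∃ i, n ≤ lam i ∧ n ≠ 0 ∧ ∃ γ ∈ monomialSemigroup n lam, e + Finsupp.single i n = γ + lam}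
  zero_mem' := Or.inl (zero_mem _)
  add_mem' := by
    have mixed : ∀ e f : Fin r →₀ ℕ, e ∈ monomialSemigroup n lam →
        ((∃ c : Fin r →₀ ℕ, f + lam = n • c) ∧ ∃ i, n ≤ lam i ∧ n ≠ 0 ∧
          ∃ γ ∈ monomialSemigroup n lam, f + Finsupp.single i n = γ + lam) →
        (e + f ∈ monomialSemigroup n lam ∨ (∃ c : Fin r →₀ ℕ, e + f + lam = n • c) ∧
          ∃ i, n ≤ lam i ∧ n ≠ 0 ∧
            ∃ γ ∈ monomialSemigroup n lam, e + f + Finsupp.single i n = γ + lam) := by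
      rintro _ f ⟨a, q, rfl⟩ ⟨⟨c, hc⟩, i, hi, hn, γ, hγ, hf⟩
      rcases q with _ | q
      · refine Or.inr ⟨⟨a + c, ?_⟩, i, hi, hn, n • a + γ,
          add_mem (nsmul_mem_monomialSemigroup a) hγ, ?_⟩
        · rw [nsmul_add, ← hc]; simp [add_assoc]
        · rw [add_assoc, add_assoc _ γ, ← hf]; simp
      -- One copy of `lam` is absorbed by `f + lam = n • c`.
      · refine Or.inl ⟨a + c, q, ?_⟩
        rw [nsmul_add, ← hc, add_nsmul, one_nsmul]
        abel
    rintro e f (he | he) (hf | hf)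
    · exact Or.inl (add_mem he hf)
    · exact mixed e f he hf
    · rw [add_comm]
      exact mixed f e hf he
    · obtain ⟨⟨c, hc⟩, -⟩ := he
      obtain ⟨-, j, hj, hn, γ, ⟨b, p, rfl⟩, hf⟩ := hf
      -- The `lam` in the relation for `f` turns `e` into `n • c`. A copy of `n θ_j` can be removed
      -- from it because `n * c j = e j + lam j ≥ n > 0`.
      refine Or.inl (mem_monomialSemigroup_of_add_single (i := j) (a := b + c) (q := p) ?_ ?_)
      · rw [add_assoc, hf, nsmul_add, ← hc]
        abel
      · have h1 := DFunLike.congr_fun hc j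
        intro h
        have hcj : c j = 0 := by simp at h; exact h.2
        simp [hcj] at h1
        omega

theorem monomialSemigroup_le_extendedSemigroup :
    monomialSemigroup n lam ≤ extendedSemigroup n lam := fun _ h => Or.inl h

theorem add_mem_of_mem_extendedSemigroup {e : Fin r →₀ ℕ} (he : e ∈ extendedSemigroup n lam) :
    e + lam ∈ monomialSemigroup n lam := by
  rcases he with he | ⟨⟨c, hc⟩, -⟩
  · exact add_mem he self_mem_monomialSemigroup
  · rw [hc]
    exact nsmul_mem_monomialSemigroup c

theorem mem_extendedSemigroup {e γ : Fin r →₀ ℕ} {i : Fin r} (hn : n ≠ 0) (hi : n ≤ lam i)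
    (hγ : γ ∈ monomialSemigroup n lam) (he : e + Finsupp.single i n = γ + lam)
    (hlam : e + lam ∈ monomialSemigroup n lam) : e ∈ extendedSemigroup n lam := by
  obtain ⟨a, q, h⟩ := hlam
  rcases q with _ | q
  · exact Or.inr ⟨⟨a, by simpa using h⟩, i, hi, hn, γ, hγ, he⟩
  · refine Or.inl ⟨a, q, add_right_cancel (b := lam) ?_⟩
    rw [h, add_nsmul, one_nsmul, add_assoc]

/-- The combinatorial core: if `∏ v_i ^ lam_i` has no exponent `e` with `lam + e < δ` outside the
allowed ones, and the `v_i ^ n` only have exponents of the expected form, then the coefficient of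
`t^δ` in `t^lam ∏ v_i ^ lam_i` vanishes, for a non-eliminable `δ`. -/
theorem coeff_prod_pow_eq_zero {δ : Fin r →₀ ℕ} (hn : n ≠ 0)
    (hδ : δ ∉ monomialSemigroup n lam)
    (hδ' : ∀ i, n ≤ lam i → ∀ γ ∈ monomialSemigroup n lam,
      δ + Finsupp.single i n ≠ γ + 2 • lam)
    {v : Fin r → MvPowerSeries (Fin r) ℂ} (hv0 : ∀ i, constantCoeff (v i) ≠ 0)
    (hv : ∀ i e, e + lam ≤ δ → coeff e (v i ^ n) ≠ 0 → e ∈ monomialSemigroup n lam ∨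
      n ≤ lam i ∧ ∃ γ ∈ monomialSemigroup n lam, e + Finsupp.single i n = γ + lam)
    (hG : ∀ e, e + lam < δ → e + lam ∉ monomialSemigroup n lam →
      coeff e (∏ i, v i ^ lam i) = 0)
    {e : Fin r →₀ ℕ} (he : e + lam = δ) : coeff e (∏ i, v i ^ lam i) = 0 := by
  -- Additivity gives `logCoeff e' (v i ^ n) = n * logCoeff e' (v i)`, so a new exponent of `v i` is
  -- already visible in `v i ^ n`.
  have hpow : ∀ {e' i}, e' ∉ extendedSemigroup n lam →
      v i ∈ unitsSupportedBelow (extendedSemigroup n lam) e' → coeff e' (v i) ≠ 0 →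
      coeff e' (v i ^ n) ≠ 0 := by
    intro e' i he' hvi hne h
    have h1 := logCoeff_pow he' hvi n
    rw [logCoeff, h, zero_div, eq_comm, mul_eq_zero, logCoeff, div_eq_zero_iff] at h1
    rcases h1 with h1 | h1 | h1
    · exact hn (by exact_mod_cast h1)
    · exact hne h1
    · exact hv0 i h1
  have below : ∀ e', e' + lam < δ → ∀ i, coeff e' (v i) ≠ 0 → e' ∈ extendedSemigroup n lam := by
    intro e'
    induction e' using WellFoundedLT.induction with
    | ind e' ih =>
      intro hlt i hne
      by_contra he'
      have hmem : ∀ j, v j ∈ unitsSupportedBelow (extendedSemigroup n lam) e' := fun j =>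
        ⟨hv0 j, fun m hm => ih m hm ((by gcongr : m + lam < e' + lam).trans hlt) j⟩
      have hsingle : ∀ j, coeff e' (v j) ≠ 0 → n ≤ lam j ∧
          ∃ γ ∈ monomialSemigroup n lam, e' + Finsupp.single j n = γ + lam := fun j hj =>
        (hv j e' hlt.le (hpow he' (hmem j) hj)).resolve_left
          fun h => he' (monomialSemigroup_le_extendedSemigroup h)
      obtain ⟨hi, γ, hγ, hγe⟩ := hsingle i hne
      -- The product has no coefficient at `e'` by `hG`, so `∑ lam j * logCoeff e' (v j) = 0`. Only
      -- the index `i` survives in the sum, and `lam i ≥ n > 0`.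
      have hprod := logCoeff_prod_pow he' Finset.univ hmem (fun j => lam j)
      rw [logCoeff, hG e' hlt fun h => he' (mem_extendedSemigroup hn hi hγ hγe h), zero_div,
        Finset.sum_eq_single i, eq_comm, mul_eq_zero, logCoeff, div_eq_zero_iff] at hprod
      · rcases hprod with h | h | h
        · have : lam i = 0 := by exact_mod_cast h
          omega
        · exact hne h
        · exact hv0 i h
      · intro j _ hji
        by_cases hj : coeff e' (v j) = 0
        · simp [logCoeff, hj]
        · obtain ⟨-, γ', hγ', hγe'⟩ := hsingle j hj
          exact absurd (monomialSemigroup_le_extendedSemigroup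
            (mem_monomialSemigroup_of_add_single_eq hn hji hγ' hγ hγe' hγe)) he'
      · simp
  have he' : e ∉ extendedSemigroup n lam := fun h =>
    hδ (he ▸ add_mem_of_mem_extendedSemigroup h)
  have hmem : ∀ j, v j ∈ unitsSupportedBelow (extendedSemigroup n lam) e := fun j =>
    ⟨hv0 j, fun m hm => below m (he ▸ (by gcongr : m + lam < e + lam)) j⟩
  have hzero : ∀ i, coeff e (v i) = 0 := by
    intro i
    by_contra hne
    rcases hv i e he.le (hpow he' (hmem i) hne) with h | ⟨hi, γ, hγ, hγe⟩
    · exact he' (monomialSemigroup_le_extendedSemigroup h)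
    -- Adding `lam` to `e + n θ_i = γ + lam` gives exactly the excluded form of `δ`.
    · refine hδ' i hi γ hγ ?_
      rw [← he, add_right_comm, hγe, two_nsmul, add_assoc]
  have hprod := logCoeff_prod_pow he' Finset.univ hmem (fun j => lam j)
  have hsum : ∑ i, (lam i : ℂ) * logCoeff e (v i) = 0 :=
    Finset.sum_eq_zero fun i _ => by simp [logCoeff, hzero i]
  rw [hsum, logCoeff, div_eq_zero_iff] at hprod
  refine hprod.resolve_right ?_
  rw [map_prod]
  exact Finset.prod_ne_zero_iff.2 fun i _ => by simpa using fun h => absurd h (hv0 i)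

end Semigroup

/-! ### Dominant exponents -/

theorem prod_X_pow_eq_monomial {k : ℕ} (d : Fin k →₀ ℕ) :
    ∏ i, (X i : MvPowerSeries (Fin k) ℂ) ^ d i = monomial d 1 := by
  rw [monomial_one_eq, Finsupp.prod_fintype _ _ fun i => pow_zero _]

theorem newtonPolyhedron_monomial_mul {k : ℕ} (v : Fin k →₀ ℕ) {u : MvPowerSeries (Fin k) ℂ}
    (hu : constantCoeff u ≠ 0) :
    newtonPolyhedron (monomial v 1 * u) = Set.Ici fun i => (v i : ℝ) := by
  have hset : {x : Fin k → ℝ | ∃ m ∈ supp (monomial v 1 * u), ∀ i, (m i : ℝ) ≤ x i} =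
      Set.Ici fun i => (v i : ℝ) := by
    ext x
    constructor
    · rintro ⟨m, hm, hx⟩ i
      have hvm : v ≤ m := by
        by_contra h
        exact hm (by rw [coeff_monomial_mul, if_neg h])
      exact (Nat.cast_le.2 (hvm i)).trans (hx i)
    · intro hx
      refine ⟨v, ?_, hx⟩
      change coeff v _ ≠ 0
      rw [coeff_monomial_mul, if_pos le_rfl]
      simpa using hu
  rw [newtonPolyhedron, hset]
  exact (convex_Ici _).convexHull_eq

theorem extremePoints_Ici {k : ℕ} (v : Fin k → ℝ) : (Set.Ici v).extremePoints ℝ = {v} := by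
  ext x
  rw [mem_extremePoints, Set.mem_singleton_iff]
  constructor
  · rintro ⟨hx, h⟩
    have hx' : v ≤ x := hx
    -- `x` is the midpoint of `v` and its reflection through `x`.
    refine (h v Set.self_mem_Ici (x + (x - v)) ?_ ?_).1.symm
    · exact hx'.trans (le_add_of_nonneg_right (sub_nonneg.2 hx'))
    · refine ⟨1 / 2, 1 / 2, by norm_num, by norm_num, by norm_num, ?_⟩
      ext i
      simp
      ring
  · rintro rfl
    refine ⟨Set.self_mem_Ici, fun y hy z hz ⟨a, b, ha, hb, hab, hx⟩ => ?_⟩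
    have key : ∀ i, y i = x i ∧ z i = x i := by
      intro i
      have h1 : x i ≤ y i := hy i
      have h2 : x i ≤ z i := hz i
      have h3 : a * y i + b * z i = x i := by simpa using congrFun hx i
      have h4 : a * (y i - x i) + b * (z i - x i) = 0 := by linear_combination h3 - x i * hab
      have h5 := mul_nonneg ha.le (sub_nonneg.2 h1)
      have h6 := mul_nonneg hb.le (sub_nonneg.2 h2)
      have h7 : a * (y i - x i) = 0 := by linarith
      have h8 : b * (z i - x i) = 0 := by linarith
      exact ⟨sub_eq_zero.1 ((mul_eq_zero.1 h7).resolve_left ha.ne'),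
        sub_eq_zero.1 ((mul_eq_zero.1 h8).resolve_left hb.ne')⟩
    exact ⟨funext fun i => (key i).1, funext fun i => (key i).2⟩

theorem hasDominantExponent_monomial_mul {k : ℕ} (v : Fin k →₀ ℕ) {u : MvPowerSeries (Fin k) ℂ}
    (hu : constantCoeff u ≠ 0) : HasDominantExponent (monomial v 1 * u) v := by
  refine ⟨fun h => hu ?_, ?_⟩
  · have := coeff_add_monomial_mul v 0 u (1 : ℂ)
    rw [h] at this
    simpa using this.symm
  · rw [newtonPolyhedron_monomial_mul v hu, extremePoints_Ici]

theorem X_mem_convergent {k : ℕ} (i : Fin k) : (X i : MvPowerSeries (Fin k) ℂ) ∈ convergent k := by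
  classical
  refine ⟨1, one_pos, summable_of_ne_finset_zero (s := {Finsupp.single i 1}) fun m hm => ?_⟩
  rw [Finset.mem_singleton] at hm
  simp [coeff_X, hm]

/-! ### Parameterizations -/

section Param

variable {r n : ℕ} {S : MvPowerSeries (Fin r) ℂ}

@[simp]
theorem paramTuple_castSucc (i : Fin r) : paramTuple n S i.castSucc = X i ^ n := by
  simp [paramTuple]

@[simp]
theorem paramTuple_last : paramTuple n S (Fin.last r) = S := by
  simp [paramTuple]

theorem constantCoeff_paramTuple (hn : n ≠ 0) (hS : constantCoeff S = 0) (j : Fin (r + 1)) :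
    constantCoeff (paramTuple n S j) = 0 := by
  induction j using Fin.lastCases with
  | last => simpa using hS
  | cast i => simp [hn]

/-- Pulling back `X^a X_{r+1}^q` gives `t^{n a + q lam}` times a unit. This is the only part of the
value semigroup that the argument needs. -/
theorem monomialSemigroup_subset_valueSemigroup {lam : Fin r →₀ ℕ} (hn : n ≠ 0)
    (hS0 : constantCoeff S = 0) {u : MvPowerSeries (Fin r) ℂ} (hu : constantCoeff u ≠ 0)
    (hS : S = u * monomial lam 1) :
    (monomialSemigroup n lam : Set (Fin r →₀ ℕ)) ⊆ valueSemigroup n S := by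
  rintro _ ⟨a, q, rfl⟩
  have hsub : HasSubst (paramTuple n S) :=
    hasSubst_of_constantCoeff_zero (constantCoeff_paramTuple hn hS0)
  refine ⟨(∏ i : Fin r, X i.castSucc ^ a i) * X (Fin.last r) ^ q,
    mul_mem (prod_mem fun i _ => pow_mem (X_mem_convergent _) _)
      (pow_mem (X_mem_convergent _) _), ?_⟩
  have h : subst (paramTuple n S) ((∏ i : Fin r, X i.castSucc ^ a i) * X (Fin.last r) ^ q :
      MvPowerSeries (Fin (r + 1)) ℂ) = monomial (n • a + q • lam) 1 * u ^ q := by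
    rw [← coe_substAlgHom hsub]
    simp only [map_mul, map_prod, map_pow, substAlgHom_X, paramTuple_castSucc, paramTuple_last]
    rw [← one_mul (1 : ℂ), ← monomial_mul_monomial, ← prod_X_pow_eq_monomial (n • a)]
    rw [show monomial (q • lam) (1 : ℂ) = monomial lam 1 ^ q by rw [monomial_pow, one_pow]]
    rw [hS, mul_pow]
    simp only [← pow_mul, Finsupp.smul_apply, smul_eq_mul]
    ring
  rw [h]
  exact hasDominantExponent_monomial_mul _ (by simpa using fun h => absurd h hu)

/-- At the origin a Weierstrass polynomial reduces to a pure power of `Y`. -/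
theorem IsBranch.constantCoeff_eq_zero [NeZero n] {f : Polynomial (convergent r)}
    (hf : IsQuasiOrdinary f) (hS : IsBranch n f S) : constantCoeff S = 0 := by
  have h := congrArg constantCoeff hS.2
  rw [Polynomial.hom_eval₂, Polynomial.eval₂_eq_sum_range, Finset.sum_range_succ,
    Finset.sum_eq_zero, map_zero] at h
  · simp [hf.monic.coeff_natDegree] at h
    exact h.1
  · intro i hi
    have := hf.weierstrass i (Finset.mem_range.1 hi)
    simp [constantCoeff_expand, this]

theorem IsQuasiOrdinaryParam.constantCoeff_eq_zero {g : ℕ} [NeZero n]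
    {lam : Fin (g + 1) → (Fin r →₀ ℕ)} (h : IsQuasiOrdinaryParam n lam S) :
    constantCoeff S = 0 := by
  obtain ⟨f, hf, hS, -⟩ := h
  exact hS.constantCoeff_eq_zero hf

theorem IsNormalizedParam.lam_ne_zero {g : ℕ} [NeZero n] {lam : Fin (g + 1) → (Fin r →₀ ℕ)}
    (h : IsNormalizedParam n lam S) : lam 0 ≠ 0 := by
  intro h0
  obtain ⟨u, -, hu, hS⟩ := h.leading
  have := h.param.constantCoeff_eq_zero
  rw [hS, h0] at this
  simp [hu] at this

/-- If `lam 0 = n θ_i`, the condition `first` excludes `i = 0`, and for `i > 0` the lexicographic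
order already fails at the first characteristic exponent. -/
theorem IsNormalizedParam.lam_ne_single {g : ℕ} [NeZero n] {lam : Fin (g + 1) → (Fin r →₀ ℕ)}
    (h : IsNormalizedParam n lam S) (i : Fin r) : Finsupp.single i n ≠ lam 0 := by
  intro hi
  have hne : ∀ j, j ≠ i → lam 0 j = 0 := fun j hj => by
    rw [← hi, Finsupp.single_eq_of_ne hj]
  have hii : lam 0 i = n := by rw [← hi, Finsupp.single_eq_same]
  by_cases h0 : (i : ℕ) = 0
  · have := h.first i h0 hne
    omega
  · have hlt : (⟨0, by omega⟩ : Fin r) < i := Fin.lt_def.2 (Nat.pos_of_ne_zero h0)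
    have hle := h.lex _ i hlt
    have hlt' : toLex (fun k => lam k ⟨0, by omega⟩) < toLex (fun k => lam k i) := by
      refine ⟨0, fun j hj => absurd hj (Fin.not_lt_zero j), ?_⟩
      change lam 0 _ < lam 0 i
      rw [hne _ hlt.ne, hii]
      exact Nat.pos_of_ne_zero (NeZero.ne n)
    exact absurd hle (not_le.2 hlt')

theorem IsQuasiShort.notMem_monomialSemigroup {g : ℕ} [NeZero n]
    {lam : Fin (g + 1) → (Fin r →₀ ℕ)} (h : IsQuasiShort n lam S) {δ : Fin r →₀ ℕ}
    (hδ : δ ∈ supp (nonleading (lam 0) S)) : δ ∉ monomialSemigroup n (lam 0) ∧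
      ∀ i, n ≤ lam 0 i → ∀ γ ∈ monomialSemigroup n (lam 0),
        δ + Finsupp.single i n ≠ γ + 2 • lam 0 := by
  obtain ⟨u, -, hu, hS⟩ := h.normalized.leading
  have hsub := monomialSemigroup_subset_valueSemigroup (n := n) (NeZero.ne n)
    h.normalized.param.constantCoeff_eq_zero (by simp [hu]) hS
  have hs := h.short δ hδ
  exact ⟨fun hm => hs (Or.inl (hsub hm)),
    fun i hi γ hγ he => hs (Or.inr ⟨i, hi, γ, hsub hγ, he⟩)⟩

end Param

/-! ### Coordinate changes -/

theorem GermIso.hasSubst_toFun {k : ℕ} (ρ : GermIso k) : HasSubst ρ.toFun :=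
  hasSubst_of_constantCoeff_zero ρ.toFun_zero

theorem GermIso.subst_toFun_subst_invFun {k : ℕ} (ρ : GermIso k) (f : MvPowerSeries (Fin k) ℂ) :
    subst ρ.toFun (subst ρ.invFun f) = f := by
  rw [subst_comp_subst_apply (hasSubst_of_constantCoeff_zero ρ.invFun_zero) ρ.hasSubst_toFun]
  simp only [ρ.left_inv]
  rw [subst_self, id]

theorem Carries.subst_paramTuple {r n : ℕ} {σ : GermIso (r + 1)} {ρ : GermIso r}
    {S₁ S₂ : MvPowerSeries (Fin r) ℂ} (h : Carries n σ ρ S₁ S₂) (j : Fin (r + 1)) :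
    subst ρ.toFun (paramTuple n S₂ j) = subst (paramTuple n S₁) (σ.toFun j) := by
  rw [h j, ρ.subst_toFun_subst_invFun]

theorem prod_X_mul_pow {k : ℕ} (v : Fin k → MvPowerSeries (Fin k) ℂ) (d : Fin k →₀ ℕ) :
    ∏ i, (X i * v i) ^ d i = monomial d 1 * ∏ i, v i ^ d i := by
  rw [← prod_X_pow_eq_monomial, ← Finset.prod_mul_distrib]
  exact Finset.prod_congr rfl fun i _ => mul_pow _ _ _

/-- The exponent `(⌈lam_1 / n⌉, …, ⌈lam_r / n⌉)`. -/
noncomputable def ceilExponent {r : ℕ} (n : ℕ) (lam : Fin r →₀ ℕ) : Fin r →₀ ℕ :=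
  Finsupp.equivFunOnFinite.symm fun i => ⌈(lam i : ℚ) / n⌉₊

theorem ceilExponent_ne_zero {r n : ℕ} (hn : n ≠ 0) {lam : Fin r →₀ ℕ} (hlam : lam ≠ 0) :
    ceilExponent n lam ≠ 0 := by
  obtain ⟨i, hi⟩ := DFunLike.ne_iff.1 hlam
  have h1 : (0 : ℚ) < lam i := by exact_mod_cast Nat.pos_of_ne_zero hi
  have h2 : (0 : ℚ) < n := by exact_mod_cast Nat.pos_of_ne_zero hn
  have h3 : 0 < ⌈(lam i : ℚ) / n⌉₊ := Nat.ceil_pos.2 (div_pos h1 h2)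
  exact DFunLike.ne_iff.2 ⟨i, h3.ne'⟩

theorem subst_ceilMonomial {r n : ℕ} {S : MvPowerSeries (Fin r) ℂ} (lam : Fin r →₀ ℕ)
    (hsub : HasSubst (paramTuple n S)) :
    subst (paramTuple n S) (ceilMonomial n lam) = monomial (n • ceilExponent n lam) 1 := by
  rw [← coe_substAlgHom hsub, ceilMonomial, ← prod_X_pow_eq_monomial]
  simp only [map_prod, map_pow, substAlgHom_X, paramTuple_castSucc, ← pow_mul]
  rfl

/-- A coefficient of a product at or below a minimal element of a set containing the support of
the first factor. -/
theorem coeff_mul_of_minimal {k : ℕ} {D : Set (Fin k →₀ ℕ)} {δ μ : Fin k →₀ ℕ}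
    (hδ : Minimal (· ∈ D) δ) (hμ : μ ≤ δ) {f : MvPowerSeries (Fin k) ℂ} (hf : supp f ⊆ D)
    (h : MvPowerSeries (Fin k) ℂ) : coeff μ (f * h) = coeff μ f * constantCoeff h := by
  classical
  rw [coeff_mul, Finset.sum_eq_single (μ, 0)]
  · simp
  · rintro ⟨a, b⟩ hab hne
    rw [Finset.HasAntidiagonal.mem_antidiagonal] at hab
    dsimp only at hab ⊢
    by_contra h0
    have haD : a ∈ D := hf (left_ne_zero_of_mul h0)
    have haμ : a ≤ μ := hab ▸ le_self_add
    have haδ : a = δ := le_antisymm (haμ.trans hμ) (hδ.2 haD (haμ.trans hμ))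
    have haμ' : a = μ := le_antisymm haμ (haδ ▸ hμ)
    refine hne (Prod.ext haμ' ?_)
    rw [haμ'] at hab
    simpa using hab
  · simp

/-- The substitution sends `t^d` to `t^d ∏ v_i^{d_i}`, so only `d ≤ μ` contribute, and minimality of
`δ` leaves `d = μ` alone. -/
theorem coeff_subst_of_minimal {k : ℕ} {D : Set (Fin k →₀ ℕ)} {δ μ : Fin k →₀ ℕ}
    (hδ : Minimal (· ∈ D) δ) (hμ : μ ≤ δ) {f : MvPowerSeries (Fin k) ℂ} (hf : supp f ⊆ D)
    {ρ v : Fin k → MvPowerSeries (Fin k) ℂ} (hsub : HasSubst ρ) (hρ : ∀ i, ρ i = X i * v i) :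
    coeff μ (subst ρ f) = (∏ i, constantCoeff (v i) ^ μ i) * coeff μ f := by
  have hterm : ∀ d : Fin k →₀ ℕ,
      (d.prod fun s e => ρ s ^ e) = monomial d 1 * ∏ i, v i ^ d i := fun d => by
    rw [Finsupp.prod_fintype _ _ fun i => pow_zero _]
    simp only [hρ]
    exact prod_X_mul_pow v d
  rw [coeff_subst hsub, finsum_eq_single _ μ]
  · have := coeff_add_monomial_mul μ 0 (∏ i, v i ^ μ i) (1 : ℂ)
    rw [add_zero] at this
    rw [hterm, this, smul_eq_mul, one_mul, coeff_zero_eq_constantCoeff_apply, map_prod, mul_comm]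
    simp
  · intro d hd
    by_cases h0 : coeff d f = 0
    · rw [h0, zero_smul]
    · rw [hterm, coeff_monomial_mul, if_neg, smul_zero]
      intro hle
      exact hd (le_antisymm hle (hμ.trans (hδ.2 (hf h0) (hle.trans hμ))))

/-! ### The main comparison of coefficients -/

/-- The supports of the non-leading parts of two parameterizations. -/
def jointSupp {r : ℕ} (lam : Fin r →₀ ℕ) (S₁ S₂ : MvPowerSeries (Fin r) ℂ) :
    Set (Fin r →₀ ℕ) :=
  supp (nonleading lam S₁) ∪ supp (nonleading lam S₂)

theorem coeff_nonleading_of_minimal {r g n : ℕ} [NeZero n] {lam : Fin (g + 1) → (Fin r →₀ ℕ)}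
    {S₁ S₂ : MvPowerSeries (Fin r) ℂ}
    (h₁ : IsQuasiShort n lam S₁) (h₂ : IsQuasiShort n lam S₂)
    {σ : GermIso (r + 1)} {ρ : GermIso r} (hcar : Carries n σ ρ S₁ S₂)
    {v : Fin r → MvPowerSeries (Fin r) ℂ} (hv0 : ∀ i, constantCoeff (v i) ≠ 0)
    (hρ : ∀ i, ρ.toFun i = X i * v i)
    {a : Fin (r + 1) → ℂ} {ε η : Fin (r + 1) → MvPowerSeries (Fin (r + 1)) ℂ}
    (hε : ∀ j, constantCoeff (ε j) = 0)
    (hη : ∀ i : Fin r, lam 0 i < n → η i.castSucc = 0)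
    (hσ : ∀ i : Fin r, σ.toFun i.castSucc = C (a i.castSucc) * X i.castSucc +
      (X i.castSucc * ε i.castSucc + X (Fin.last r) * η i.castSucc))
    (hσ' : σ.toFun (Fin.last r) = C (a (Fin.last r)) * X (Fin.last r) +
      (X (Fin.last r) * ε (Fin.last r) + ceilMonomial n (lam 0) * η (Fin.last r)))
    {δ : Fin r →₀ ℕ} (hδ : Minimal (· ∈ jointSupp (lam 0) S₁ S₂) δ) :
    (∏ i, constantCoeff (v i) ^ δ i) * coeff δ (nonleading (lam 0) S₂) =
      a (Fin.last r) * coeff δ (nonleading (lam 0) S₁) := by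
  classical
  have hn : n ≠ 0 := NeZero.ne n
  have hlam := h₁.normalized.lam_ne_zero
  have hlam_pos : 0 < lam 0 := pos_iff_ne_zero.2 hlam
  have hS0 := h₁.normalized.param.constantCoeff_eq_zero
  have hH0 := constantCoeff_paramTuple hn hS0
  have hsub : HasSubst (paramTuple n S₁) := hasSubst_of_constantCoeff_zero hH0
  have hN₁ : S₁ = monomial (lam 0) 1 + nonleading (lam 0) S₁ := by simp [nonleading]
  have hN₂ : S₂ = monomial (lam 0) 1 + nonleading (lam 0) S₂ := by simp [nonleading]
  have hs₁ : supp (nonleading (lam 0) S₁) ⊆ jointSupp (lam 0) S₁ S₂ := Set.subset_union_left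
  have hs₂ : supp (nonleading (lam 0) S₂) ⊆ jointSupp (lam 0) S₁ S₂ := Set.subset_union_right
  set Γ := monomialSemigroup n (lam 0)
  obtain ⟨hδΓ, hδ'⟩ : δ ∉ Γ ∧ ∀ i, n ≤ lam 0 i → ∀ γ ∈ Γ,
      δ + Finsupp.single i n ≠ γ + 2 • lam 0 := by
    rcases hδ.1 with h | h
    · exact h₁.notMem_monomialSemigroup h
    · exact h₂.notMem_monomialSemigroup h
  set U := upperClosure (jointSupp (lam 0) S₁ S₂)
  have hbelow : ∀ {μ}, μ < δ → μ ∉ U := by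
    intro μ hμ h
    obtain ⟨d, hd, hdμ⟩ := mem_upperClosure.1 h
    exact (hdμ.trans_lt hμ).not_ge (hδ.2 hd (hdμ.trans hμ.le))
  -- `Γ ∪ U` is again a semigroup, so it contains the exponents of every series in the components of
  -- `H₁`. Since `U` does not meet the exponents strictly below `δ`, only `Γ` is left there.
  have hmem : ∀ j, paramTuple n S₁ j ∈ supportedIn (Γ.unionUpper U) := by
    intro j m hm
    induction j using Fin.lastCases with
    | last =>
      rw [paramTuple_last, hN₁, map_add] at hm
      by_cases hml : m = lam 0
      · exact Or.inl (hml ▸ self_mem_monomialSemigroup)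
      · rw [coeff_monomial_ne hml, zero_add] at hm
        exact Or.inr (mem_upperClosure.2 ⟨m, hs₁ hm, le_rfl⟩)
    | cast i =>
      rw [paramTuple_castSucc, X_pow_eq] at hm
      rw [eq_of_coeff_monomial_ne_zero hm]
      refine Or.inl ?_
      simpa using nsmul_mem_monomialSemigroup (n := n) (lam := lam 0) (Finsupp.single i 1)
  have hring : ∀ (h : MvPowerSeries (Fin (r + 1)) ℂ) {μ}, μ ∉ U → coeff μ (subst (paramTuple n S₁) h) ≠ 0 → μ ∈ Γ := by
    intro h μ hμ hne
    exact (subst_mem_supportedIn hsub hmem h μ hne).resolve_right hμ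
  have hmul : ∀ (h : MvPowerSeries (Fin (r + 1)) ℂ) {μ}, μ ∉ U → coeff μ (S₁ * subst (paramTuple n S₁) h) ≠ 0 →
      ∃ γ ∈ Γ, μ = γ + lam 0 := by
    intro h μ hμ hne
    rw [hN₁, add_mul, map_add, ← hN₁] at hne
    have h0 : coeff μ (nonleading (lam 0) S₁ * subst (paramTuple n S₁) h) = 0 := by
      rw [coeff_mul]
      refine Finset.sum_eq_zero fun p hp => ?_
      rw [Finset.HasAntidiagonal.mem_antidiagonal] at hp
      by_contra hc
      exact hμ (mem_upperClosure.2 ⟨p.1, hs₁ (left_ne_zero_of_mul hc), hp ▸ le_self_add⟩)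
    rw [h0, add_zero, coeff_monomial_mul] at hne
    split_ifs at hne with hle
    · rw [one_mul] at hne
      exact ⟨μ - lam 0, hring h (fun h' => hμ (U.upper tsub_le_self h')) hne,
        (tsub_add_cancel_of_le hle).symm⟩
    · exact absurd rfl hne
  have hv : ∀ i e, e + lam 0 ≤ δ → coeff e (v i ^ n) ≠ 0 → e ∈ Γ ∨
      n ≤ lam 0 i ∧ ∃ γ ∈ Γ, e + Finsupp.single i n = γ + lam 0 := by
    intro i e he hne
    have heU : e ∉ U := hbelow ((lt_add_of_pos_right e hlam_pos).trans_le he)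
    have h := hcar.subst_paramTuple i.castSucc
    rw [paramTuple_castSucc, subst_pow ρ.hasSubst_toFun, subst_X ρ.hasSubst_toFun, hρ, mul_pow,
      hσ, X_pow_eq, ← coe_substAlgHom hsub] at h
    simp only [map_add, map_mul, substAlgHom_X, paramTuple_castSucc, paramTuple_last] at h
    rw [coe_substAlgHom hsub, subst_C, X_pow_eq] at h
    -- Shifting by `n θ_i` cancels the factor `t_i^n`. For `e ∉ Γ` only the term `S₁ · η_i(H₁)` can
    -- contribute.
    have hc := congrArg (coeff (Finsupp.single i n + e)) h
    rw [map_add, map_add, mul_comm (C _), coeff_add_monomial_mul, coeff_add_monomial_mul,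
      coeff_add_monomial_mul, one_mul, one_mul, one_mul, coeff_C] at hc
    by_contra! hcon
    obtain ⟨hcon₁, hcon₂⟩ := hcon
    rw [if_neg fun h0 : e = 0 => hcon₁ (h0 ▸ zero_mem _), zero_add,
      not_imp_comm.1 (hring (ε i.castSucc) heU) hcon₁, zero_add] at hc
    rw [hc] at hne
    rcases lt_or_ge (lam 0 i) n with hi | hi
    · rw [hη i hi, ← coe_substAlgHom hsub, map_zero, mul_zero, map_zero] at hne
      exact hne rfl
    · have hlt : Finsupp.single i n < lam 0 :=
        lt_of_le_of_ne (Finsupp.single_le_iff.2 hi) (h₁.normalized.lam_ne_single i)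
      obtain ⟨γ, hγ, hγe⟩ := hmul _ (hbelow ((by rw [add_comm]; gcongr :
        Finsupp.single i n + e < e + lam 0).trans_le he)) hne
      exact hcon₂ hi γ hγ (by rw [add_comm, hγe])
  have heq : ∀ μ ≤ δ, μ ∉ Γ → coeff μ (monomial (lam 0) 1 * ∏ i, v i ^ lam 0 i) +
      (∏ i, constantCoeff (v i) ^ μ i) * coeff μ (nonleading (lam 0) S₂) =
        a (Fin.last r) * coeff μ (nonleading (lam 0) S₁) := by
    intro μ hμ hμΓ
    -- A non-zero shift leaves an exponent strictly below `δ`, hence in `Γ`; adding `x` back would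
    -- put `μ` in `Γ`. This removes the `η_{r+1}` term and the leading part of `S₁ · ε_{r+1}(H₁)`.
    have hsmall : ∀ x : Fin r →₀ ℕ, x ≠ 0 → x ∈ Γ → ∀ h : MvPowerSeries (Fin (r + 1)) ℂ,
        coeff μ (monomial x 1 * subst (paramTuple n S₁) h) = 0 := by
      intro x hx hxΓ h
      rw [coeff_monomial_mul]
      split_ifs with hle
      · rw [one_mul]
        by_contra hne
        have hlt : μ - x < μ := by
          conv_rhs => rw [← tsub_add_cancel_of_le hle]
          exact lt_add_of_pos_right _ (pos_iff_ne_zero.2 hx)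
        have := hring h (hbelow (hlt.trans_le hμ)) hne
        exact hμΓ (tsub_add_cancel_of_le hle ▸ add_mem this hxΓ)
      · rfl
    have h := congrArg (coeff μ) (hcar.subst_paramTuple (Fin.last r))
    rw [paramTuple_last, hN₂, subst_add ρ.hasSubst_toFun,
      subst_monomial ρ.hasSubst_toFun, map_one, one_mul,
      Finsupp.prod_fintype _ _ fun i => pow_zero _, map_add,
      coeff_subst_of_minimal hδ hμ hs₂ ρ.hasSubst_toFun hρ] at h
    simp only [hρ] at h
    rw [prod_X_mul_pow] at h
    rw [h, hσ', ← coe_substAlgHom hsub]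
    simp only [map_add, map_mul, substAlgHom_X, paramTuple_last]
    rw [coe_substAlgHom hsub, subst_C, subst_ceilMonomial _ hsub,
      hsmall _ (smul_ne_zero hn (ceilExponent_ne_zero hn hlam))
        (nsmul_mem_monomialSemigroup _), add_zero, coeff_C_mul]
    conv_lhs => rw [hN₁, add_mul, ← hN₁]
    rw [map_add, hsmall _ hlam self_mem_monomialSemigroup,
      coeff_mul_of_minimal hδ hμ hs₁, constantCoeff_subst_eq_zero hsub hH0 (hε _), nonleading, map_sub,
      coeff_monomial_ne (m := μ) (n := lam 0) fun h => hμΓ (h ▸ self_mem_monomialSemigroup)]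
    ring
  have hG : ∀ e, e + lam 0 < δ → e + lam 0 ∉ Γ → coeff e (∏ i, v i ^ lam 0 i) = 0 := by
    intro e he heΓ
    have hz : ∀ {N : MvPowerSeries (Fin r) ℂ}, supp N ⊆ jointSupp (lam 0) S₁ S₂ → coeff (e + lam 0) N = 0 := by
      intro N hN
      by_contra h0
      exact he.not_ge (hδ.2 (hN h0) he.le)
    have h := heq _ he.le heΓ
    -- Strictly below `δ` both non-leading parts vanish, so the last component becomes a constraint
    -- on the `v i` alone.
    rw [hz hs₁, hz hs₂, add_comm e, coeff_add_monomial_mul] at h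
    simpa using h
  have hfin := heq δ le_rfl hδΓ
  rw [coeff_monomial_mul] at hfin
  split_ifs at hfin with hle
  · rwa [coeff_prod_pow_eq_zero hn hδΓ hδ' hv0 hv hG (tsub_add_cancel_of_le hle), mul_zero,
      zero_add] at hfin
  · rwa [zero_add] at hfin

/-! ### Invariance of the generalized Zariski exponents -/

/-- By well-foundedness every element of `A` lies above a minimal element of `A ∪ B`, and by
hypothesis that element belongs to `A`. -/
theorem minimal_supp_of_minimal {α : Type*} [PartialOrder α] [WellFoundedLT α] {A B : Set α}
    (h : ∀ δ, Minimal (· ∈ A ∪ B) δ → (δ ∈ A ↔ δ ∈ B)) (δ : α) :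
    Minimal (· ∈ A ∪ B) δ ↔ Minimal (· ∈ A) δ := by
  constructor
  · intro hδ
    exact ⟨hδ.1.elim id (h δ hδ).2, fun _ hx => hδ.2 (Or.inl hx)⟩
  · intro hδ
    obtain ⟨m, hmδ, hm⟩ := exists_minimal_le_of_wellFoundedLT (· ∈ A ∪ B) δ (Or.inl hδ.1)
    have hmA : m ∈ A := hm.1.elim id (h m hm).2
    rwa [le_antisymm (hδ.2 hmA hmδ) hmδ]

theorem supp_eq_empty_iff {k : ℕ} {q : MvPowerSeries (Fin k) ℂ} : supp q = ∅ ↔ q = 0 := by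
  simp [supp, Set.eq_empty_iff_forall_notMem, MvPowerSeries.ext_iff]

theorem zariskiExponents_eq_of_minimal {r : ℕ} {lam : Fin r →₀ ℕ}
    {S₁ S₂ : MvPowerSeries (Fin r) ℂ} (h : ∀ δ, Minimal (· ∈ jointSupp lam S₁ S₂) δ →
      (coeff δ (nonleading lam S₁) ≠ 0 ↔ coeff δ (nonleading lam S₂) ≠ 0)) :
    zariskiExponents lam S₁ = zariskiExponents lam S₂ := by
  unfold jointSupp at h
  have hmin : ∀ δ, Minimal (· ∈ supp (nonleading lam S₁)) δ ↔
      Minimal (· ∈ supp (nonleading lam S₂)) δ := by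
    intro δ
    rw [← minimal_supp_of_minimal h, Set.union_comm, minimal_supp_of_minimal]
    intro m hm
    rw [Set.union_comm] at hm
    exact (h m hm).symm
  have hzero : nonleading lam S₁ = 0 ↔ nonleading lam S₂ = 0 := by
    have hne : ∀ A : Set (Fin r →₀ ℕ), A = ∅ ↔ ∀ δ, ¬ Minimal (· ∈ A) δ := by
      intro A
      constructor
      · rintro rfl δ hδ
        exact hδ.1
      · intro hA
        by_contra hc
        obtain ⟨x, hx⟩ := Set.nonempty_iff_ne_empty.2 hc
        obtain ⟨m, -, hm⟩ := exists_minimal_le_of_wellFoundedLT (· ∈ A) x hx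
        exact hA m hm
    rw [← supp_eq_empty_iff, ← supp_eq_empty_iff, hne, hne]
    simp only [hmin]
  unfold zariskiExponents
  by_cases h0 : nonleading lam S₁ = 0
  · rw [if_pos h0, if_pos (hzero.1 h0)]
  · rw [if_neg h0, if_neg (hzero.not.1 h0)]
    simp only [hmin]

theorem constantCoeff_eq_one_of_sameOneJet {r : ℕ} {i : Fin r} {v : MvPowerSeries (Fin r) ℂ}
    (h : SameOneJet (X i * v) (X i)) : constantCoeff v = 1 := by
  have := h (Finsupp.single i 1) (by simp)
  rw [← add_zero (Finsupp.single i 1), X, coeff_add_monomial_mul, add_zero,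
    coeff_monomial_same, one_mul] at this
  simpa using this

/-- Since `lam ≠ 0`, the ceiling monomial is divisible by some `X_i` with `i ≤ r`. It therefore
contributes nothing to the coefficient of `X_{r+1}`, and neither does `X_{r+1} ε`, because `ε`
vanishes at the origin. -/
theorem eq_one_of_sameOneJet {r n : ℕ} (hn : n ≠ 0) {lam : Fin r →₀ ℕ} (hlam : lam ≠ 0) {a : ℂ}
    {ε η : MvPowerSeries (Fin (r + 1)) ℂ} (hε : constantCoeff ε = 0)
    (h : SameOneJet (C a * X (Fin.last r) + (X (Fin.last r) * ε + ceilMonomial n lam * η))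
      (X (Fin.last r))) : a = 1 := by
  classical
  obtain ⟨i, hi⟩ := DFunLike.ne_iff.1 (ceilExponent_ne_zero hn hlam)
  have hi : ⌈(lam i : ℚ) / n⌉₊ ≠ 0 := hi
  have hceil : coeff (Finsupp.single (Fin.last r) 1) (ceilMonomial n lam * η) = 0 := by
    obtain ⟨w, hw⟩ : X i.castSucc ∣ ceilMonomial n lam :=
      (dvd_pow_self _ hi).trans (Finset.dvd_prod_of_mem _ (Finset.mem_univ i))
    rw [hw, mul_assoc, X, coeff_monomial_mul, if_neg]
    intro hle
    have := hle i.castSucc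
    simp at this
  have hX : coeff (Finsupp.single (Fin.last r) 1) (X (Fin.last r) * ε) = 0 := by
    have := coeff_add_monomial_mul (Finsupp.single (Fin.last r) 1) 0 ε (1 : ℂ)
    rw [add_zero] at this
    rw [X, this]
    simpa using hε
  have := h (Finsupp.single (Fin.last r) 1) (by simp)
  rw [map_add, map_add, hceil, hX, coeff_C_mul, X, coeff_monomial_same] at this
  simpa using this

theorem mainTheorem1 (r g n : ℕ) [NeZero n] (lam : Fin (g + 1) → (Fin r →₀ ℕ))
    (S₁ S₂ : MvPowerSeries (Fin r) ℂ)
    (h₁ : IsQuasiShort n lam S₁) (h₂ : IsQuasiShort n lam S₂) :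
    ((∃ p ∈ Atilde n (lam 0), Carries n p.1 p.2 S₁ S₂) →
      zariskiExponents (lam 0) S₁ = zariskiExponents (lam 0) S₂) ∧
    ((∃ p ∈ AtildeOne n (lam 0), Carries n p.1 p.2 S₁ S₂) →
      ∀ δ : Fin r →₀ ℕ, (δ : WithTop (Fin r →₀ ℕ)) ∈ zariskiExponents (lam 0) S₁ →
        coeff δ S₂ = coeff δ S₁) := by
  have key : ∀ p ∈ Atilde n (lam 0), Carries n p.1 p.2 S₁ S₂ →
      ∃ (c : Fin r → ℂ) (b : ℂ), (∀ i, c i ≠ 0) ∧ b ≠ 0 ∧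
        (∀ δ, Minimal (· ∈ jointSupp (lam 0) S₁ S₂) δ →
          (∏ i, c i ^ δ i) * coeff δ (nonleading (lam 0) S₂) =
            b * coeff δ (nonleading (lam 0) S₁)) ∧
        (p ∈ AtildeOne n (lam 0) → (∀ i, c i = 1) ∧ b = 1) := by
    rintro ⟨σ, ρ⟩ ⟨c, ζ, a, ε, η, hc, ha, hζ, hε, -, hη, hρ, hσ, hσ'⟩ hcar
    have hv : ∀ i, constantCoeff (C (c i) + ζ i) = c i := fun i => by simp [(hζ i).2]
    refine ⟨c, a (Fin.last r), hc, ha _, fun δ hδ => ?_, ?_⟩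
    · have := coeff_nonleading_of_minimal h₁ h₂ hcar (v := fun i => C (c i) + ζ i)
        (fun i => by simpa only [hv] using hc i) hρ (fun j => (hε j).2) hη hσ hσ' hδ
      simpa only [hv] using this
    · rintro ⟨-, -, hlast, hone⟩
      refine ⟨fun i => ?_, ?_⟩
      · rw [← hv i]
        refine constantCoeff_eq_one_of_sameOneJet (i := i) ?_
        rw [← hρ i]
        exact hone i
      · refine eq_one_of_sameOneJet (ε := ε (Fin.last r)) (η := η (Fin.last r)) (NeZero.ne n)
          h₁.normalized.lam_ne_zero (hε _).2 ?_
        rw [← hσ']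
        exact hlast
  have hiff : ∀ p ∈ Atilde n (lam 0), Carries n p.1 p.2 S₁ S₂ →
      ∀ δ, Minimal (· ∈ jointSupp (lam 0) S₁ S₂) δ →
        (coeff δ (nonleading (lam 0) S₁) ≠ 0 ↔ coeff δ (nonleading (lam 0) S₂) ≠ 0) := by
    intro p hp hcar δ hδ
    obtain ⟨c, b, hc, hb, h, -⟩ := key p hp hcar
    have hprod : ∏ i, c i ^ δ i ≠ 0 := Finset.prod_ne_zero_iff.2 fun i _ => pow_ne_zero _ (hc i)
    rw [← mul_ne_zero_iff_left (b := coeff δ (nonleading (lam 0) S₂)) hprod, h δ hδ,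
      mul_ne_zero_iff_left hb]
  refine ⟨fun ⟨p, hp, hcar⟩ => zariskiExponents_eq_of_minimal (hiff p hp hcar),
    fun ⟨p, hp, hcar⟩ δ hδ => ?_⟩
  obtain ⟨c, b, -, -, h, hone⟩ := key p hp.1 hcar
  obtain ⟨hc, rfl⟩ := hone hp
  unfold zariskiExponents at hδ
  split_ifs at hδ with h0
  · exact absurd hδ (WithTop.coe_ne_top)
  · obtain ⟨δ', hδ', he⟩ := hδ
    obtain rfl : δ' = δ := WithTop.coe_injective he
    -- The exponent is minimal for `S₁` only; it is first promoted to a minimal element of the joint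
    -- support. The common leading monomial then cancels.
    have := h δ' ((minimal_supp_of_minimal (hiff p hp.1 hcar) δ').2 hδ')
    simpa [hc, nonleading] using this
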